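/- **Group law.** Let $C: y^2=f(x)=ax^4+bx^3+cx^2+dx+e$ be a quartic model over $\mathbb Q$ describing a smooth genus one curve. $C(\mathbb Q)$ consists of the rational affine points together with one point $\infty_r$ at infinity for each $r\in\mathbb Q$ with $r^2=a$. If $e=\varepsilon^2$ with $\varepsilon\in\mathbb Q^\times$, let $$E:\ Y^2+a_1XY+a_3Y=X^3+a_2X^2+a_4X+a_6,\qquad a_1=\tfrac d\varepsilon,\ a_2=c-\tfrac{d^2}{4\varepsilon^2},\ a_3=2\varepsilon b,\ a_4=-4\varepsilon^2a,\ a_6=a_2a_4,$$ and let $\phi_1:C\to E$ be the isomorphism given by $$X=\frac{2\varepsilon(y+\varepsilon)+dx}{x^2},\qquad Y=\frac{4\varepsilon^2(y+\varepsilon)+2\varepsilon(dx+cx^2)-d^2x^2/(2\varepsilon)}{x^3},$$ with $\phi_1(0,\varepsilon)=O_E$ (so $\phi_1(0,-\varepsilon)=(-a_2,a_1a_2-a_3)$ and $\phi_1(\infty_r)=(2\varepsilon r,0)$). For a point $P=(x_0,y_0)\in C(\mathbb Q)$ with $y_0\neq0$, let $\phi_P$ be the translation $x\mapsto x-x_0$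 followed by the map $\phi_1$ of the translated curve with $\varepsilon=y_0$, so $\phi_P(P)=O$. The group law on $C(\mathbb Q)$ with identity $P$ is the one transported by $\phi_P$, and $2C(\mathbb Q)$ is the set of $Q\in C(\mathbb Q)$ with $\phi_P(Q)=2\phi_P(R)$ for some $R\in C(\mathbb Q)$. **(1)** Let $C: y^2=\prod_{i=1}^4 f_i(x)$, $f_i(x)=a_ix+b_i$, $a_i\in\mathbb Q^\times$, $b_i\in\mathbb Q$, be a smooth genus one curve, and let $(x_0,y_0)\in C(\mathbb Q)$, with $x_0\ne -b_i/a_i$ for all $i$, be the identity of the group law. Assume that $f_i(x_0)f_j(x_0)$ is a rational square for all $i,j$. Then a point $Q\in C(\mathbb Q)$ lies in $2C(\mathbb Q)$ if and only if there is $\delta_Q\in\mathbb Q$ such that for every $i$ one has $f_i(x(Q))=\delta_Qz_i^2$ for some $z_i\in\mathbb Q$. (If $Q$ is a point at infinity, $f_i(x(Q))$ is read as $a_i$.) **(2)** Let $q\in\mathbb Q^\times$. A rational $D(q)$-$m$-tuple is a set of $m$ nonzero rationals such that $st+q$ is a rational square for any two distinct members $s,t$. Let $S=\{a_1,a_2,a_3,a_4\}$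 be a rational $D(q)$-quadruple and let $C_S: y^2=\prod_{i=1}^4(a_ix+q)$, with the group law on $C_S(\mathbb Q)$ given by $\phi_1$ with $\varepsilon=q^2$, that is with identity $(0,q^2)$. Then $S$ is contained in a rational $D(q)$-quintuple if and only if there is an affine point $Q\in 2C_S(\mathbb Q)$ with $x(Q)\notin\{0,a_1,a_2,a_3,a_4\}$ for which $\delta_Q$ is a square in $\mathbb Q$, where $\delta_Q$ is a rational number such that each $a_ix(Q)+q$ equals $\delta_Qz_i^2$ with $z_i\in\mathbb Q$ (unique up to multiplication by a nonzero rational square). -/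

import Mathlib

/-- The quartic model `y² = a x⁴ + b x³ + c x² + d x + e` over `ℚ`. -/
structure Quartic where
  a : ℚ
  b : ℚ
  c : ℚ
  d : ℚ
  e : ℚ

namespace Quartic

/-- The right-hand side of the quartic model, evaluated at `x`. -/
def eval (C : Quartic) (x : ℚ) : ℚ :=
  C.a * x ^ 4 + C.b * x ^ 3 + C.c * x ^ 2 + C.d * x + C.e

/-- The invariant `I` of the quartic. -/
def I (C : Quartic) : ℚ := 12 * C.a * C.e - 3 * C.b * C.d + C.c ^ 2

/-- The invariant `J` of the quartic. -/
def J (C : Quartic) : ℚ :=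
  72 * C.a * C.c * C.e - 27 * C.a * C.d ^ 2 - 27 * C.b ^ 2 * C.e + 9 * C.b * C.c * C.d
    - 2 * C.c ^ 3

/-- The discriminant of the quartic model: `1728 Δ = c₄³ - c₆²` with `c₄ = 2⁴ I`, `c₆ = 2⁵ J`.
The model describes a smooth curve of genus one if and only if `Δ ≠ 0`. -/
def Δ (C : Quartic) : ℚ := ((2 ^ 4 * C.I) ^ 3 - (2 ^ 5 * C.J) ^ 2) / 1728

/-- The rational points of the smooth projective curve described by the quartic model: the affine
points `(x, y)`, and the points `(1 : r : 0)` at infinity, one for every rational square root `r`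
of the leading coefficient. -/
inductive Point (C : Quartic) : Type
  | affine (x y : ℚ) (h : y ^ 2 = C.eval x) : Point C
  | infinity (r : ℚ) (h : r ^ 2 = C.a) : Point C

/-- The Weierstrass curve `E` attached to the model `v² = a u⁴ + b u³ + c u² + d u + q²`. -/
def jacobian (C : Quartic) (q : ℚ) : WeierstrassCurve ℚ where
  a₁ := C.d / q
  a₂ := C.c - C.d ^ 2 / (4 * q ^ 2)
  a₃ := 2 * q * C.b
  a₄ := -4 * q ^ 2 * C.a
  a₆ := (C.c - C.d ^ 2 / (4 * q ^ 2)) * (-4 * q ^ 2 * C.a)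

theorem jacobian_Δ (C : Quartic) {q : ℚ} (hq : q ≠ 0) (he : C.e = q ^ 2) :
    (C.jacobian q).Δ = C.Δ := by
  simp only [WeierstrassCurve.Δ, WeierstrassCurve.b₂, WeierstrassCurve.b₄, WeierstrassCurve.b₆,
    WeierstrassCurve.b₈, jacobian, Δ, I, J, he]
  field_simp
  ring

theorem jacobian_nonsingular (C : Quartic) {q : ℚ} (hq : q ≠ 0) (he : C.e = q ^ 2)
    (hΔ : C.Δ ≠ 0) {x y : ℚ} (h : (C.jacobian q).toAffine.Equation x y) :
    (C.jacobian q).toAffine.Nonsingular x y :=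
  (WeierstrassCurve.Affine.equation_iff_nonsingular_of_Δ_ne_zero
    (by rw [jacobian_Δ C hq he]; exact hΔ)).mp h

theorem equation_generic (C : Quartic) {q : ℚ} (hq : q ≠ 0) (he : C.e = q ^ 2) {u v : ℚ}
    (hu : u ≠ 0) (h : v ^ 2 = C.eval u) :
    (C.jacobian q).toAffine.Equation ((2 * q * (v + q) + C.d * u) / u ^ 2)
      ((4 * q ^ 2 * (v + q) + 2 * q * (C.d * u + C.c * u ^ 2) - C.d ^ 2 * u ^ 2 / (2 * q))
        / u ^ 3) := by
  have ha : C.a = (v ^ 2 - C.b * u ^ 3 - C.c * u ^ 2 - C.d * u - q ^ 2) / u ^ 4 := by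
    rw [eval, he] at h
    field_simp
    linarith
  rw [WeierstrassCurve.Affine.equation_iff]
  simp only [jacobian, ha]
  field_simp
  ring

theorem equation_neg (C : Quartic) {q : ℚ} (hq : q ≠ 0) :
    (C.jacobian q).toAffine.Equation (-(C.jacobian q).a₂)
      ((C.jacobian q).a₁ * (C.jacobian q).a₂ - (C.jacobian q).a₃) := by
  rw [WeierstrassCurve.Affine.equation_iff]
  simp only [jacobian]
  field_simp
  ring

theorem equation_infinity (C : Quartic) {q : ℚ} (hq : q ≠ 0) {r : ℚ} (h : r ^ 2 = C.a) :
    (C.jacobian q).toAffine.Equation (2 * q * r) 0 := by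
  rw [WeierstrassCurve.Affine.equation_iff]
  simp only [jacobian, ← h]
  field_simp
  ring

/-- The isomorphism `φ₁` from `v² = a u⁴ + b u³ + c u² + d u + q²` to `E`, on rational points:
`x = (2q(v+q) + du)/u²`, `y = (4q²(v+q) + 2q(du+cu²) - d²u²/(2q))/u³` where these formulas make
sense, and their unique extension to the remaining points, namely `(0, q) ↦ O`,
`(0, -q) ↦ (-a₂, a₁a₂ - a₃)` and `(1 : r : 0) ↦ (2qr, 0)`. -/
def phi1 (C : Quartic) (q : ℚ) (hq : q ≠ 0) (he : C.e = q ^ 2) (hΔ : C.Δ ≠ 0) :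
    C.Point → (C.jacobian q).toAffine.Point
  | .affine u v h =>
    if hu : u = 0 then
      if v = q then 0
      else .some (-(C.jacobian q).a₂)
        ((C.jacobian q).a₁ * (C.jacobian q).a₂ - (C.jacobian q).a₃)
        (C.jacobian_nonsingular hq he hΔ (C.equation_neg hq))
    else .some ((2 * q * (v + q) + C.d * u) / u ^ 2)
      ((4 * q ^ 2 * (v + q) + 2 * q * (C.d * u + C.c * u ^ 2) - C.d ^ 2 * u ^ 2 / (2 * q)) / u ^ 3)
      (C.jacobian_nonsingular hq he hΔ (C.equation_generic hq he hu h))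
  | .infinity r h =>
    .some (2 * q * r) 0 (C.jacobian_nonsingular hq he hΔ (C.equation_infinity hq h))

/-- The quartic model obtained by the substitution `x = u + t`. -/
def translate (C : Quartic) (t : ℚ) : Quartic where
  a := C.a
  b := 4 * C.a * t + C.b
  c := 6 * C.a * t ^ 2 + 3 * C.b * t + C.c
  d := 4 * C.a * t ^ 3 + 3 * C.b * t ^ 2 + 2 * C.c * t + C.d
  e := C.eval t

theorem eval_translate (C : Quartic) (t u : ℚ) : (C.translate t).eval u = C.eval (u + t) := by
  simp only [translate, eval]
  ring

theorem translate_Δ (C : Quartic) (t : ℚ) : (C.translate t).Δ = C.Δ := by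
  have hI : (C.translate t).I = C.I := by
    simp only [translate, I, eval]
    ring
  have hJ : (C.translate t).J = C.J := by
    simp only [translate, J, eval]
    ring
  rw [Δ, Δ, hI, hJ]

/-- The isomorphism `(x, y) ↦ (x - t, y)` between the two models, on rational points. -/
def translatePoint (C : Quartic) (t : ℚ) : C.Point → (C.translate t).Point
  | .affine x y h => .affine (x - t) y (by rw [eval_translate, sub_add_cancel]; exact h)
  | .infinity r h => .infinity r h

/-- An isomorphism `φ` from `C` to its Jacobian that sends a given affine point `(x₀, y₀)` with
`y₀ ≠ 0` to `O`: move the point to `(0, y₀)` by a translation, then apply `φ₁`. -/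
def phiAt (C : Quartic) (x₀ y₀ : ℚ) (h₀ : y₀ ^ 2 = C.eval x₀) (hy₀ : y₀ ≠ 0) (hΔ : C.Δ ≠ 0)
    (Q : C.Point) : ((C.translate x₀).jacobian y₀).toAffine.Point :=
  (C.translate x₀).phi1 y₀ hy₀ h₀.symm (by rw [translate_Δ]; exact hΔ) (C.translatePoint x₀ Q)

/-- The set `2C(ℚ)` for the group law that an isomorphism `φ : C → E` onto an elliptic curve
induces on `C(ℚ)`: all `Q = R + R`, that is `φ(Q) = φ(R) + φ(R)`, with `R ∈ C(ℚ)`. -/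
def doubles {C : Quartic} {E : WeierstrassCurve ℚ} (φ : C.Point → E.toAffine.Point) :
    Set C.Point :=
  {Q | ∃ R : C.Point, φ Q = φ R + φ R}

/-- The value of the linear form `αx + β` at a point of `C`; at infinity this is the leading
coefficient, which is the value of the form `αx + βz` at `(1 : r : 0)`. -/
def linVal {C : Quartic} (α β : ℚ) : C.Point → ℚ
  | .affine x _ _ => α * x + β
  | .infinity _ _ => α

/-- The quartic model `y² = (a₀x+b₀)(a₁x+b₁)(a₂x+b₂)(a₃x+b₃)`. -/
def ofLinear (a b : Fin 4 → ℚ) : Quartic where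
  a := a 0 * a 1 * a 2 * a 3
  b := b 0 * a 1 * a 2 * a 3 + a 0 * b 1 * a 2 * a 3 + a 0 * a 1 * b 2 * a 3
    + a 0 * a 1 * a 2 * b 3
  c := a 0 * a 1 * b 2 * b 3 + a 0 * b 1 * a 2 * b 3 + a 0 * b 1 * b 2 * a 3
    + b 0 * a 1 * a 2 * b 3 + b 0 * a 1 * b 2 * a 3 + b 0 * b 1 * a 2 * a 3
  d := a 0 * b 1 * b 2 * b 3 + b 0 * a 1 * b 2 * b 3 + b 0 * b 1 * a 2 * b 3
    + b 0 * b 1 * b 2 * a 3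
  e := b 0 * b 1 * b 2 * b 3

theorem eval_ofLinear (a b : Fin 4 → ℚ) (x : ℚ) :
    (ofLinear a b).eval x = ∏ i, (a i * x + b i) := by
  simp only [ofLinear, eval, Fin.prod_univ_four]
  ring

theorem ofLinear_y_ne_zero {a b : Fin 4 → ℚ} (ha : ∀ i, a i ≠ 0) {x₀ y₀ : ℚ}
    (h₀ : y₀ ^ 2 = (ofLinear a b).eval x₀) (hx₀ : ∀ i, x₀ ≠ -b i / a i) : y₀ ≠ 0 := by
  rintro rfl
  rw [eval_ofLinear] at h₀
  have h : ∏ i, (a i * x₀ + b i) = 0 := by rw [← h₀]; norm_num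
  obtain ⟨i, -, hi⟩ := Finset.prod_eq_zero_iff.mp h
  apply hx₀ i
  rw [eq_div_iff (ha i)]
  linarith

theorem ofLinear_Δ (a b : Fin 4 → ℚ) :
    (ofLinear a b).Δ = 16 * ((a 0 * b 1 - a 1 * b 0) * (a 2 * b 3 - a 3 * b 2)) ^ 2
      * ((a 0 * b 2 - a 2 * b 0) * (a 1 * b 3 - a 3 * b 1)) ^ 2
      * ((a 0 * b 3 - a 3 * b 0) * (a 1 * b 2 - a 2 * b 1)) ^ 2 := by
  set A := (a 0 * b 1 - a 1 * b 0) * (a 2 * b 3 - a 3 * b 2) with hA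
  set B := (a 0 * b 2 - a 2 * b 0) * (a 1 * b 3 - a 3 * b 1) with hB
  have hD : (a 0 * b 3 - a 3 * b 0) * (a 1 * b 2 - a 2 * b 1) = B - A := by
    rw [hA, hB]; ring
  have hI : (ofLinear a b).I = A ^ 2 - A * B + B ^ 2 := by
    rw [hA, hB]; simp only [ofLinear, I]; ring
  have hJ : (ofLinear a b).J = -((A + B) * (2 * A - B) * (A - 2 * B)) := by
    rw [hA, hB]; simp only [ofLinear, J]; ring
  rw [hD, Δ, hI, hJ]
  ring

end Quartic

/-- The curve `C_S : y² = (a₀x+q)(a₁x+q)(a₂x+q)(a₃x+q)`. -/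
def quadrupleCurve (q : ℚ) (a : Fin 4 → ℚ) : Quartic := Quartic.ofLinear a (fun _ => q)

theorem quadrupleCurve_e (q : ℚ) (a : Fin 4 → ℚ) : (quadrupleCurve q a).e = (q ^ 2) ^ 2 := by
  simp only [quadrupleCurve, Quartic.ofLinear]
  ring

theorem quadrupleCurve_Δ {q : ℚ} (hq : q ≠ 0) {a : Fin 4 → ℚ} (ha : Function.Injective a) :
    (quadrupleCurve q a).Δ ≠ 0 := by
  have h : ∀ i j, i ≠ j → a i * q - a j * q ≠ 0 := fun i j hij => by
    rw [← sub_mul]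
    exact mul_ne_zero (sub_ne_zero.mpr (ha.ne hij)) hq
  rw [quadrupleCurve, Quartic.ofLinear_Δ]
  refine mul_ne_zero (mul_ne_zero (mul_ne_zero (by norm_num) ?_) ?_) ?_ <;>
  refine pow_ne_zero 2 (mul_ne_zero (h _ _ ?_) (h _ _ ?_)) <;> decide

/-- A rational `D(q)`-`m`-tuple: a set of `m` nonzero rationals such that `st + q` is a rational
square for any two distinct members `s`, `t`. -/
def IsDTuple (q : ℚ) (m : ℕ) (S : Finset ℚ) : Prop :=
  S.card = m ∧ (∀ s ∈ S, s ≠ 0) ∧ ∀ s ∈ S, ∀ t ∈ S, s ≠ t → IsSquare (s * t + q)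

/-! Write F = f_i f_j and G = f_k f_l for a splitting of the quartic into two quadratics. The three
such splittings give the three rational 2-torsion points of E, with X-coordinates e₁, e₂, e₃. By
complete 2-descent (`exists_add_self_iff`), an affine point of E is a double exactly when every X -
e_m is a square. With the identity moved to x = 0, the hypothesis makes F(0) = s² and G(0) = t² up
to square classes that agree, and F·(X - e_m) is then a square on C (`isSquare_linVal_mul_sub`). So
Q is a double iff the products f_i f_j are squares at Q, that is, iff all f_i(Q) lie in one square
class. At most one f_i(Q) and at most one X - e_m can vanish, and complementary pairs of factors
cover these cases. Surjectivity of `phi1` puts the half of the point back on C. For (2), every form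
a_i x + q equals q at 0, so (1) applies. A new member x makes every a_i x + q a square, which is the
case where δ is a square. -/

namespace WeierstrassCurve

/-- The `2`-division polynomial of `W` is `4 (x - e₁) (x - e₂) (x - e₃)`. -/
structure SplitTwoTorsion {F : Type*} [Field F] (W : WeierstrassCurve F) (e₁ e₂ e₃ : F) :
    Prop where
  b₂_eq : W.b₂ = -4 * (e₁ + e₂ + e₃)
  b₄_eq : W.b₄ = 2 * (e₁ * e₂ + e₁ * e₃ + e₂ * e₃)
  b₆_eq : W.b₆ = -4 * (e₁ * e₂ * e₃)

/-! ### Complete 2-descent on a Weierstrass curve with rational 2-torsion -/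

namespace SplitTwoTorsion

variable {F : Type*} [Field F] {W : WeierstrassCurve F} {e₁ e₂ e₃ : F}

theorem swap (h : W.SplitTwoTorsion e₁ e₂ e₃) : W.SplitTwoTorsion e₂ e₁ e₃ :=
  ⟨by rw [h.b₂_eq]; ring, by rw [h.b₄_eq]; ring, by rw [h.b₆_eq]; ring⟩

theorem rotate (h : W.SplitTwoTorsion e₁ e₂ e₃) : W.SplitTwoTorsion e₃ e₁ e₂ :=
  ⟨by rw [h.b₂_eq]; ring, by rw [h.b₄_eq]; ring, by rw [h.b₆_eq]; ring⟩

theorem sq_eq (h : W.SplitTwoTorsion e₁ e₂ e₃) {x y : F} (hxy : W.toAffine.Equation x y) :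
    (2 * y + W.a₁ * x + W.a₃) ^ 2 = 4 * ((x - e₁) * (x - e₂) * (x - e₃)) := by
  have h₂ := h.b₂_eq
  have h₄ := h.b₄_eq
  have h₆ := h.b₆_eq
  rw [b₂] at h₂
  rw [b₄] at h₄
  rw [b₆] at h₆
  rw [Affine.equation_iff] at hxy
  linear_combination 4 * hxy + x ^ 2 * h₂ + 2 * x * h₄ + h₆

/-- The `x`-coordinate of a double differs from that of a `2`-torsion point by a square. -/
theorem isSquare_addX_sub (h : W.SplitTwoTorsion e₁ e₂ e₃) (two_ne : (2 : F) ≠ 0) [DecidableEq F]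
    {x y : F} (hxy : W.toAffine.Equation x y) (hy : y ≠ W.toAffine.negY x y) :
    IsSquare (W.toAffine.addX x x (W.toAffine.slope x x y y) - e₁) := by
  have hD := h.sq_eq hxy
  have hD0 : y - W.toAffine.negY x y ≠ 0 := sub_ne_zero.mpr hy
  have hD1 : y - W.toAffine.negY x y = 2 * y + W.a₁ * x + W.a₃ := by rw [Affine.negY]; ring
  rw [Affine.slope_of_Y_ne rfl hy, Affine.addX]
  rw [hD1] at hD0 ⊢
  set D := 2 * y + W.a₁ * x + W.a₃ with hDdef
  -- The numerator is (x - e₁)² - (e₁ - e₂)(e₁ - e₃), as in the classical duplication formula.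
  refine ⟨((x - e₁) * (x - e₂) + (x - e₁) * (x - e₃) - (x - e₂) * (x - e₃)) / D, ?_⟩
  have h₂ := h.b₂_eq
  have h₄ := h.b₄_eq
  rw [b₂] at h₂
  rw [b₄] at h₄
  have hN : 2 * (3 * x ^ 2 + 2 * W.a₂ * x + W.a₄ - W.a₁ * y) = 2 * ((x - e₁) * (x - e₂)
      + (x - e₁) * (x - e₃) + (x - e₂) * (x - e₃)) - W.a₁ * D := by
    rw [hDdef]; linear_combination x * h₂ + h₄
  have h4 : (4 : F) ≠ 0 := by
    rw [show (4 : F) = 2 * 2 by norm_num]; exact mul_ne_zero two_ne two_ne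
  generalize 3 * x ^ 2 + 2 * W.a₂ * x + W.a₄ - W.a₁ * y = N at hN ⊢
  field_simp
  apply mul_left_cancel₀ h4
  linear_combination (2 * N + W.a₁ * D + 2 * ((x - e₁) * (x - e₂)
      + (x - e₁) * (x - e₃) + (x - e₂) * (x - e₃))) * hN - D ^ 2 * h₂
      - 4 * (2 * x - e₂ - e₃) * hD

/-- Halving a point whose `x`-coordinate differs from all `2`-torsion points by squares. -/
theorem exists_add_self (h : W.SplitTwoTorsion e₁ e₂ e₃) (two_ne : (2 : F) ≠ 0) [DecidableEq F]
    (hΔ : W.Δ ≠ 0) (h₁₂ : e₁ ≠ e₂) (h₁₃ : e₁ ≠ e₃) (h₂₃ : e₂ ≠ e₃)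
    {x y : F} (hxy : W.toAffine.Nonsingular x y) (h₁ : IsSquare (x - e₁))
    (h₂ : IsSquare (x - e₂)) (h₃ : IsSquare (x - e₃)) :
    ∃ R : W.toAffine.Point, Affine.Point.some x y hxy = R + R := by
  -- Negating all three roots flips the sign of their product, so the roots can be matched to y
  -- rather than to its negative.
  obtain ⟨r₁, r₂, r₃, hr₁, hr₂, hr₃, hr⟩ : ∃ r₁ r₂ r₃ : F, x - e₁ = r₁ * r₁ ∧ x - e₂ = r₂ * r₂ ∧
      x - e₃ = r₃ * r₃ ∧ 2 * y + W.a₁ * x + W.a₃ = 2 * (r₁ * r₂ * r₃) := by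
    obtain ⟨r₁, hr₁⟩ := h₁
    obtain ⟨r₂, hr₂⟩ := h₂
    obtain ⟨r₃, hr₃⟩ := h₃
    have hs := h.sq_eq hxy.1
    have : (2 * y + W.a₁ * x + W.a₃) ^ 2 = (2 * (r₁ * r₂ * r₃)) ^ 2 := by
      rw [hs, hr₁, hr₂, hr₃]; ring
    rcases sq_eq_sq_iff_eq_or_eq_neg.mp this with h | h
    · exact ⟨r₁, r₂, r₃, hr₁, hr₂, hr₃, h⟩
    · exact ⟨-r₁, -r₂, -r₃, by rw [hr₁]; ring, by rw [hr₂]; ring, by rw [hr₃]; ring,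
        by rw [h]; ring⟩
  have hb₂ := h.b₂_eq
  have hb₄ := h.b₄_eq
  have hb₆ := h.b₆_eq
  rw [b₂] at hb₂
  rw [b₄] at hb₄
  rw [b₆] at hb₆
  obtain rfl : e₁ = x - r₁ * r₁ := by rw [← hr₁]; ring
  obtain rfl : e₂ = x - r₂ * r₂ := by rw [← hr₂]; ring
  obtain rfl : e₃ = x - r₃ * r₃ := by rw [← hr₃]; ring
  have h₁₂' : r₁ + r₂ ≠ 0 := fun h0 => h₁₂ (by linear_combination (r₂ - r₁) * h0)
  have h₁₃' : r₁ + r₃ ≠ 0 := fun h0 => h₁₃ (by linear_combination (r₃ - r₁) * h0)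
  have h₂₃' : r₂ + r₃ ≠ 0 := fun h0 => h₂₃ (by linear_combination (r₃ - r₂) * h0)
  -- The half: X - e₁ = (r₁ + r₂)(r₁ + r₃), and cyclically, so the product of the three differences
  -- is H². The tangent there has slope r₁ + r₂ + r₃ - a₁/2.
  set X := x + r₁ * r₂ + r₁ * r₃ + r₂ * r₃ with hX
  set H := (r₁ + r₂) * (r₁ + r₃) * (r₂ + r₃) with hH
  have hH0 : H ≠ 0 := mul_ne_zero (mul_ne_zero h₁₂' h₁₃') h₂₃'
  obtain ⟨Y, hY⟩ : ∃ Y, 2 * Y + W.a₁ * X + W.a₃ = 2 * H :=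
    ⟨H - (W.a₁ * X + W.a₃) / 2, by field_simp; ring⟩
  have h4 : (4 : F) ≠ 0 := by
    rw [show (4 : F) = 2 * 2 by norm_num]; exact mul_ne_zero two_ne two_ne
  have heq : W.toAffine.Equation X Y := by
    rw [Affine.equation_iff]
    apply mul_left_cancel₀ h4
    have : (2 * Y + W.a₁ * X + W.a₃) ^ 2 = (2 * H) ^ 2 := by rw [hY]
    linear_combination this - X ^ 2 * hb₂ - 2 * X * hb₄ - hb₆
  have hD : Y - W.toAffine.negY X Y = 2 * H := by
    rw [← hY, Affine.negY]; ring
  have hne : Y ≠ W.toAffine.negY X Y := by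
    rw [← sub_ne_zero, hD]; exact mul_ne_zero two_ne hH0
  have hslope : 2 * W.toAffine.slope X X Y Y = 2 * (r₁ + r₂ + r₃) - W.a₁ := by
    rw [Affine.slope_of_Y_ne rfl hne, hD]
    field_simp
    apply mul_left_cancel₀ two_ne
    linear_combination X * hb₂ + hb₄ - W.a₁ * hY
  have haddX : W.toAffine.addX X X (W.toAffine.slope X X Y Y) = x := by
    rw [Affine.addX]
    apply mul_left_cancel₀ h4
    linear_combination (2 * W.toAffine.slope X X Y Y + 2 * (r₁ + r₂ + r₃) + W.a₁) * hslope - hb₂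
  refine ⟨.some X Y ((Affine.equation_iff_nonsingular_of_Δ_ne_zero hΔ).mp heq), ?_⟩
  rw [Affine.Point.add_self_of_Y_ne hne, Affine.Point.some.injEq]
  refine ⟨haddX.symm, ?_⟩
  rw [Affine.addY, Affine.negAddY, haddX, Affine.negY]
  apply mul_left_cancel₀ two_ne
  linear_combination hr + hY + (x - X) * hslope

/-- Complete `2`-descent: the doubles among the affine points of a Weierstrass curve with full
rational `2`-torsion. -/
theorem exists_add_self_iff (h : W.SplitTwoTorsion e₁ e₂ e₃) (two_ne : (2 : F) ≠ 0)
    [DecidableEq F] (hΔ : W.Δ ≠ 0) (h₁₂ : e₁ ≠ e₂) (h₁₃ : e₁ ≠ e₃) (h₂₃ : e₂ ≠ e₃)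
    {x y : F} (hxy : W.toAffine.Nonsingular x y) :
    (∃ R : W.toAffine.Point, Affine.Point.some x y hxy = R + R) ↔
      IsSquare (x - e₁) ∧ IsSquare (x - e₂) ∧ IsSquare (x - e₃) := by
  refine ⟨?_, fun ⟨h₁, h₂, h₃⟩ => h.exists_add_self two_ne hΔ h₁₂ h₁₃ h₂₃ hxy h₁ h₂ h₃⟩
  rintro ⟨_ | ⟨X, Y, hXY⟩, hR⟩
  · exact absurd (hR.trans (add_zero _)) (Affine.Point.some_ne_zero hxy)
  · by_cases hY : Y = W.toAffine.negY X Y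
    · rw [Affine.Point.add_self_of_Y_eq hY] at hR
      exact absurd hR (Affine.Point.some_ne_zero hxy)
    · rw [Affine.Point.add_self_of_Y_ne hY, Affine.Point.some.injEq] at hR
      rw [hR.1]
      exact ⟨h.isSquare_addX_sub two_ne hXY.1 hY, h.swap.isSquare_addX_sub two_ne hXY.1 hY,
        h.rotate.isSquare_addX_sub two_ne hXY.1 hY⟩

end SplitTwoTorsion

end WeierstrassCurve

/-! ### Square classes -/

theorem IsSquare.of_mul_left {F : Type*} [Field F] {x y : F} (hx : x ≠ 0) (h : IsSquare x)
    (hxy : IsSquare (x * y)) : IsSquare y := by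
  have := hxy.div h
  rwa [mul_div_cancel_left₀ y hx] at this

theorem IsSquare.exists_eq_mul_sq {F : Type*} [Field F] {x y : F} (hx : x ≠ 0)
    (hxy : IsSquare (x * y)) : ∃ z, y = x * z ^ 2 := by
  obtain ⟨w, hw⟩ := hxy
  refine ⟨w / x, ?_⟩
  field_simp
  linear_combination hw

/-- Four elements, at most one of which vanishes, lie in one square class as soon as the products
along a cycle are squares. -/
theorem exists_eq_mul_sq_of_cycle {F : Type*} [Field F] {x y z w : F} (hxy : IsSquare (x * y))
    (hyw : IsSquare (y * w)) (hxz : IsSquare (x * z)) (hzw : IsSquare (z * w))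
    (hxw₀ : x ≠ 0 ∨ w ≠ 0) (hyz₀ : y ≠ 0 ∨ z ≠ 0) :
    ∃ δ, (∃ r, x = δ * r ^ 2) ∧ (∃ r, y = δ * r ^ 2) ∧ (∃ r, z = δ * r ^ 2) ∧
      ∃ r, w = δ * r ^ 2 := by
  by_cases hx : x = 0
  · have hw : w ≠ 0 := hxw₀.resolve_left (not_not.mpr hx)
    rw [mul_comm] at hyw hzw
    exact ⟨w, ⟨0, by simp [hx]⟩, hyw.exists_eq_mul_sq hw, hzw.exists_eq_mul_sq hw, 1, by simp⟩
  · obtain ⟨r, hr⟩ := hxy.exists_eq_mul_sq hx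
    obtain ⟨s, hs⟩ := hxz.exists_eq_mul_sq hx
    refine ⟨x, ⟨1, by simp⟩, ⟨r, hr⟩, ⟨s, hs⟩, ?_⟩
    rcases hyz₀ with hy | hz
    · obtain ⟨t, ht⟩ := hyw.exists_eq_mul_sq hy
      exact ⟨r * t, by rw [ht, hr]; ring⟩
    · obtain ⟨t, ht⟩ := hzw.exists_eq_mul_sq hz
      exact ⟨s * t, by rw [ht, hs]; ring⟩

/-! ### Inverting φ₁ -/

namespace Quartic

/-- Solving the formula for X for v gives v = -q + u(uX - d)/(2q). Then `hX` is the quartic equation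
multiplied by 4q²/u², and `hY` is the formula for Y with v eliminated. -/
theorem exists_phi1_eq_some (C : Quartic) {q : ℚ} (hq : q ≠ 0) (he : C.e = q ^ 2) (hΔ : C.Δ ≠ 0)
    {X Y u : ℚ} (h : (C.jacobian q).toAffine.Nonsingular X Y) (hu : u ≠ 0)
    (hY : Y * u = 2 * q * (X + (C.jacobian q).a₂))
    (hX : (u * (X ^ 2 + (C.jacobian q).a₄)
      - 2 * q * ((C.jacobian q).a₁ * X + (C.jacobian q).a₃)) * u
      = 4 * q ^ 2 * (X + (C.jacobian q).a₂)) :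
    ∃ P, C.phi1 q hq he hΔ P = .some X Y h := by
  simp only [jacobian] at hY hX
  refine ⟨.affine u (-q + u * (u * X - C.d) / (2 * q)) ?_, ?_⟩
  · rw [eval, he]
    field_simp at hX ⊢
    linear_combination u ^ 2 * hX
  · rw [phi1, dif_neg hu, WeierstrassCurve.Affine.Point.some.injEq]
    constructor
    · field_simp
      ring
    · rw [div_eq_iff (pow_ne_zero 3 hu), show Y * u ^ 3 = Y * u * u ^ 2 by ring, hY]
      field_simp
      ring

/-- Because a₆ = a₂a₄, the equation of E factors as Y(Y + a₁X + a₃) = (X + a₂)(X² + a₄). Generically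
u = 2q(X + a₂)/Y inverts φ₁; the remaining cases are those where factors vanish. -/
theorem phi1_surjective (C : Quartic) {q : ℚ} (hq : q ≠ 0) (he : C.e = q ^ 2) (hΔ : C.Δ ≠ 0) :
    Function.Surjective (C.phi1 q hq he hΔ) := by
  rintro (_ | ⟨X, Y, h⟩)
  · exact ⟨.affine 0 q (by simp [eval, he]), by simp [phi1]; rfl⟩
  have hE : Y * (Y + (C.jacobian q).a₁ * X + (C.jacobian q).a₃)
      = (X + (C.jacobian q).a₂) * (X ^ 2 + (C.jacobian q).a₄) := by
    have h6 : (C.jacobian q).a₆ = (C.jacobian q).a₂ * (C.jacobian q).a₄ := rfl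
    have := (WeierstrassCurve.Affine.equation_iff ..).mp h.1
    linear_combination this + h6
  have hinf (h4 : X ^ 2 + (C.jacobian q).a₄ = 0) (hY : Y = 0) :
      ∃ P, C.phi1 q hq he hΔ P = .some X Y h := by
    refine ⟨.infinity (X / (2 * q)) ?_, ?_⟩
    · simp only [jacobian] at h4
      field_simp
      linear_combination h4
    · rw [phi1, WeierstrassCurve.Affine.Point.some.injEq]
      exact ⟨by field_simp, hY.symm⟩
  by_cases hX : X + (C.jacobian q).a₂ = 0
  · rw [hX, zero_mul] at hE
    by_cases hY : Y + (C.jacobian q).a₁ * X + (C.jacobian q).a₃ = 0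
    · refine ⟨.affine 0 (-q) (by simp [eval, he]), ?_⟩
      have hqq : -q ≠ q := fun h => hq (by linarith)
      rw [phi1, dif_pos rfl, if_neg hqq, WeierstrassCurve.Affine.Point.some.injEq]
      exact ⟨by linear_combination -hX, by linear_combination (C.jacobian q).a₁ * hX - hY⟩
    · obtain rfl : Y = 0 := (mul_eq_zero.mp hE).resolve_right hY
      by_cases h4 : X ^ 2 + (C.jacobian q).a₄ = 0
      · exact hinf h4 rfl
      · rw [zero_add] at hY
        -- Here 2q(X + a₂)/Y is 0/0. The condition `hX` has right-hand side zero, and its nonzero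
        -- root is this u.
        refine C.exists_phi1_eq_some hq he hΔ h (u := 2 * q * ((C.jacobian q).a₁ * X
          + (C.jacobian q).a₃) / (X ^ 2 + (C.jacobian q).a₄)) (by positivity) (by simp [hX]) ?_
        rw [hX, div_mul_cancel₀ _ h4]
        ring
  · by_cases hY : Y = 0
    · rw [hY, zero_mul, eq_comm] at hE
      exact hinf ((mul_eq_zero.mp hE).resolve_left hX) hY
    · have hu : Y * (2 * q * (X + (C.jacobian q).a₂) / Y) = 2 * q * (X + (C.jacobian q).a₂) := by
        field_simp
      refine C.exists_phi1_eq_some hq he hΔ h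
        (u := 2 * q * (X + (C.jacobian q).a₂) / Y) (by positivity) hu ?_
      generalize 2 * q * (X + (C.jacobian q).a₂) / Y = u at hu
      apply mul_left_cancel₀ hX
      linear_combination -u ^ 2 * hE + (u * Y + 2 * q * (X + (C.jacobian q).a₂)
        + u * ((C.jacobian q).a₁ * X + (C.jacobian q).a₃)) * hu

theorem eq_affine_of_phi1_eq_zero (C : Quartic) {q : ℚ} (hq : q ≠ 0) (he : C.e = q ^ 2)
    (hΔ : C.Δ ≠ 0) {Q : C.Point} (hQ : C.phi1 q hq he hΔ Q = 0) :
    ∃ h, Q = .affine 0 q h := by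
  rcases Q with ⟨u, v, h⟩ | ⟨r, h⟩
  · rw [phi1] at hQ
    split_ifs at hQ with hu hv
    · subst hu hv
      exact ⟨h, rfl⟩
  · exact absurd hQ (WeierstrassCurve.Affine.Point.some_ne_zero _)

/-! ### Descent on the quartic -/

/-- For a factorization of the quartic into quadratics `F`, `G`, the function `X - e` on the
jacobian, where `e` is the corresponding `2`-torsion point, agrees with `F` up to squares. -/
theorem isSquare_linVal_mul_sub {C : Quartic} {α₀ α₁ α₂ α₃ β₀ β₁ β₂ β₃ : ℚ}
    (hC : C = ofLinear ![α₀, α₁, α₂, α₃] ![β₀, β₁, β₂, β₃]) {q : ℚ} (hq : q ≠ 0)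
    (he : C.e = q ^ 2) (hΔ : C.Δ ≠ 0) (hβ : IsSquare (β₀ * β₁)) {Q : C.Point} {X Y : ℚ}
    {h : (C.jacobian q).toAffine.Nonsingular X Y} (hQ : C.phi1 q hq he hΔ Q = .some X Y h) :
    IsSquare (linVal α₀ β₀ Q * linVal α₁ β₁ Q
      * (X + (α₀ * α₁ * (β₂ * β₃) + α₂ * α₃ * (β₀ * β₁)))) := by
  obtain ⟨s, hs⟩ := hβ
  have hq2 : s * s * (β₂ * β₃) = q ^ 2 := by
    rw [← hs, ← he, hC]
    simp [ofLinear]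
    ring
  have hs0 : s ≠ 0 := by
    rintro rfl
    exact hq (by simpa using hq2.symm)
  obtain ⟨t, rfl⟩ : ∃ t, q = s * t := ⟨q / s, by field_simp⟩
  have ht0 : t ≠ 0 := right_ne_zero_of_mul hq
  have ht : β₂ * β₃ = t * t := by
    apply mul_left_cancel₀ (mul_ne_zero hs0 hs0)
    rw [hq2]; ring
  have hCa : C.a = α₀ * α₁ * (α₂ * α₃) := by rw [hC]; simp [ofLinear]; ring
  have hCd : C.d = (α₀ * β₁ + α₁ * β₀) * (t * t) + (α₂ * β₃ + α₃ * β₂) * (s * s) := by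
    rw [hC, ← hs, ← ht]; simp [ofLinear]; ring
  have hCc : C.c = α₀ * α₁ * (t * t) + (α₀ * β₁ + α₁ * β₀) * (α₂ * β₃ + α₃ * β₂)
      + α₂ * α₃ * (s * s) := by
    rw [hC, ← hs, ← ht]; simp [ofLinear]; ring
  rcases Q with ⟨u, v, hv⟩ | ⟨r, hr⟩
  · rw [phi1] at hQ
    split_ifs at hQ with hu hv
    · rw [WeierstrassCurve.Affine.Point.some.injEq] at hQ
      subst hu
      -- The limit at (0, -st) of the generic root (tF + sv)/u used below, that is, the derivative
      -- of tF + sv there.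
      refine ⟨s * ((α₀ * β₁ + α₁ * β₀) * (t * t) - (α₂ * β₃ + α₃ * β₂) * (s * s))
        / (2 * s * t), ?_⟩
      rw [← hQ.1]
      simp only [linVal, jacobian, mul_zero, zero_add, hs, ht, hCd, hCc]
      field_simp
      ring
    · rw [WeierstrassCurve.Affine.Point.some.injEq] at hQ
      have hv' : v ^ 2 = (α₀ * u + β₀) * (α₁ * u + β₁)
          * ((α₂ * u + β₂) * (α₃ * u + β₃)) := by
        rw [hv, hC, eval_ofLinear]
        simp [Fin.prod_univ_four]
        ring
      -- With v² = FG, one has u²(X - e) = t²F + 2stv + s²G; multiplying by F gives (tF + sv)².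
      refine ⟨(t * ((α₀ * u + β₀) * (α₁ * u + β₁)) + s * v) / u, ?_⟩
      rw [← hQ.1]
      simp only [linVal, hs, ht, hCd]
      field_simp
      linear_combination (-s ^ 2) * hv'
        - (α₀ * u + β₀) * (α₁ * u + β₁) * (t ^ 2 * hs + s ^ 2 * ht)
  · rw [phi1, WeierstrassCurve.Affine.Point.some.injEq] at hQ
    rw [hCa] at hr
    -- The leading coefficient of tF + sv, since v/u² tends to r.
    refine ⟨t * (α₀ * α₁) + s * r, ?_⟩
    rw [← hQ.1]
    simp only [linVal, hs, ht]
    linear_combination (-s ^ 2) * hr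

theorem linVal_ne_zero_or {C : Quartic} {α β α' β' : ℚ} (h : α * β' - α' * β ≠ 0)
    (hα : α ≠ 0) (Q : C.Point) : linVal α β Q ≠ 0 ∨ linVal α' β' Q ≠ 0 := by
  rcases Q with ⟨u, v, hv⟩ | ⟨r, hr⟩
  · by_contra! h0
    simp only [linVal] at h0
    exact h (by linear_combination α * h0.2 - α' * h0.1)
  · exact Or.inl hα

/-- One root for each partition of the four linear factors into two pairs. -/
theorem splitTwoTorsion_jacobian_ofLinear (a b : Fin 4 → ℚ) {q : ℚ} (hq : q ≠ 0)
    (he : (ofLinear a b).e = q ^ 2) :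
    ((ofLinear a b).jacobian q).SplitTwoTorsion
      (-(a 0 * a 1 * (b 2 * b 3) + a 2 * a 3 * (b 0 * b 1)))
      (-(a 0 * a 2 * (b 1 * b 3) + a 1 * a 3 * (b 0 * b 2)))
      (-(a 0 * a 3 * (b 1 * b 2) + a 1 * a 2 * (b 0 * b 3))) := by
  have he' : b 0 * b 1 * b 2 * b 3 = q ^ 2 := he
  constructor
  · simp only [WeierstrassCurve.b₂, jacobian, ofLinear]
    field_simp
    ring
  · simp only [WeierstrassCurve.b₄, jacobian, ofLinear]
    field_simp
    linear_combination (4 * (a 0 * a 1 * a 2 * a 3)) * he'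
  · simp only [WeierstrassCurve.b₆, jacobian, ofLinear]
    field_simp
    rw [← he']
    ring

theorem mem_doubles_phi1_iff {C : Quartic} {a b : Fin 4 → ℚ} (hC : C = ofLinear a b) {q : ℚ}
    (hq : q ≠ 0) (he : C.e = q ^ 2) (hΔ : C.Δ ≠ 0) (ha : ∀ i, a i ≠ 0)
    (hb : ∀ i j, IsSquare (b i * b j)) (Q : C.Point) :
    Q ∈ doubles (C.phi1 q hq he hΔ) ↔ ∃ δ : ℚ, ∀ i, ∃ z : ℚ, linVal (a i) (b i) Q = δ * z ^ 2 := by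
  subst hC
  have hdet : ∀ i j, i < j → a i * b j - a j * b i ≠ 0 := by
    have h := hΔ
    rw [ofLinear_Δ] at h
    simp only [ne_eq, mul_eq_zero, pow_eq_zero_iff, OfNat.ofNat_ne_zero, not_false_eq_true,
      not_or, false_or] at h
    intro i j hij
    fin_cases i <;> fin_cases j <;> first | exact absurd hij (by decide) | tauto
  have hsplit := splitTwoTorsion_jacobian_ofLinear a b hq he
  have hdoubles : Q ∈ doubles ((ofLinear a b).phi1 q hq he hΔ) ↔
      ∃ R, (ofLinear a b).phi1 q hq he hΔ Q = R + R :=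
    ⟨fun ⟨R, hR⟩ => ⟨_, hR⟩, fun ⟨R, hR⟩ => by
      obtain ⟨R, rfl⟩ := (ofLinear a b).phi1_surjective hq he hΔ R
      exact ⟨R, hR⟩⟩
  rw [hdoubles]
  rcases hQ : (ofLinear a b).phi1 q hq he hΔ Q with _ | ⟨X, Y, h⟩
  · obtain ⟨h, rfl⟩ := eq_affine_of_phi1_eq_zero _ hq he hΔ hQ
    have hb0 : b 0 ≠ 0 := by
      intro h0
      simp [ofLinear, h0] at he
      exact hq (by simpa using he.symm)
    refine ⟨fun _ => ⟨b 0, fun i => ?_⟩, fun _ => ⟨0, (add_zero _).symm⟩⟩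
    obtain ⟨z, hz⟩ := (hb 0 i).exists_eq_mul_sq hb0
    exact ⟨z, by simpa [linVal] using hz⟩
  · have hΔ' : ((ofLinear a b).jacobian q).Δ ≠ 0 := by rwa [jacobian_Δ _ hq he]
    -- Each difference of two roots is, up to sign, a product of two of the determinants in `hdet`.
    rw [hsplit.exists_add_self_iff two_ne_zero hΔ' ?_ ?_ ?_ h]
    rotate_left
    · intro h0
      refine mul_ne_zero (hdet 0 3 (by decide)) (hdet 1 2 (by decide)) ?_
      linear_combination -h0
    · intro h0
      refine mul_ne_zero (hdet 0 2 (by decide)) (hdet 1 3 (by decide)) ?_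
      linear_combination -h0
    · intro h0
      refine mul_ne_zero (hdet 0 1 (by decide)) (hdet 2 3 (by decide)) ?_
      linear_combination -h0
    simp only [sub_neg_eq_add]
    have hsq (i j k l : Fin 4) (hp : ofLinear a b
        = ofLinear ![a i, a j, a k, a l] ![b i, b j, b k, b l]) :
        IsSquare (linVal (a i) (b i) Q * linVal (a j) (b j) Q
          * (X + (a i * a j * (b k * b l) + a k * a l * (b i * b j)))) :=
      isSquare_linVal_mul_sub hp hq he hΔ (hb i j) hQ
    have h01 := hsq 0 1 2 3 (by simp [ofLinear])
    have h23 := hsq 2 3 0 1 (by simp [ofLinear]; ring_nf; simp)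
    have h02 := hsq 0 2 1 3 (by simp [ofLinear]; ring_nf; simp)
    have h13 := hsq 1 3 0 2 (by simp [ofLinear]; ring_nf; simp)
    have h03 := hsq 0 3 1 2 (by simp [ofLinear]; ring_nf; simp)
    have h12 := hsq 1 2 0 3 (by simp [ofLinear]; ring_nf; simp)
    have hne (i j : Fin 4) (hij : i ≠ j) : linVal (a i) (b i) Q ≠ 0 ∨ linVal (a j) (b j) Q ≠ 0 := by
      rcases lt_or_gt_of_ne hij with hij | hij
      · exact linVal_ne_zero_or (hdet i j hij) (ha i) Q
      · exact (linVal_ne_zero_or (hdet j i hij) (ha j) Q).symm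
    -- Complementary pairs share the same 2-torsion point, so six relations involve only three
    -- values m₁, m₂, m₃.
    rw [add_comm (a 2 * a 3 * _)] at h23
    rw [add_comm (a 1 * a 3 * _)] at h13
    rw [add_comm (a 1 * a 2 * _)] at h12
    have hm₁₂ : X + (a 0 * a 1 * (b 2 * b 3) + a 2 * a 3 * (b 0 * b 1)) ≠ 0
        ∨ X + (a 0 * a 2 * (b 1 * b 3) + a 1 * a 3 * (b 0 * b 2)) ≠ 0 := by
      by_contra! h0
      refine mul_ne_zero (hdet 0 3 (by decide)) (hdet 1 2 (by decide)) ?_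
      linear_combination h0.1 - h0.2
    have hm₁₃ : X + (a 0 * a 1 * (b 2 * b 3) + a 2 * a 3 * (b 0 * b 1)) ≠ 0
        ∨ X + (a 0 * a 3 * (b 1 * b 2) + a 1 * a 2 * (b 0 * b 3)) ≠ 0 := by
      by_contra! h0
      refine mul_ne_zero (hdet 0 2 (by decide)) (hdet 1 3 (by decide)) ?_
      linear_combination h0.1 - h0.2
    have hm₂₃ : X + (a 0 * a 2 * (b 1 * b 3) + a 1 * a 3 * (b 0 * b 2)) ≠ 0
        ∨ X + (a 0 * a 3 * (b 1 * b 2) + a 1 * a 2 * (b 0 * b 3)) ≠ 0 := by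
      by_contra! h0
      refine mul_ne_zero (hdet 0 1 (by decide)) (hdet 2 3 (by decide)) ?_
      linear_combination h0.1 - h0.2
    generalize X + (a 0 * a 1 * (b 2 * b 3) + a 2 * a 3 * (b 0 * b 1)) = m₁ at *
    generalize X + (a 0 * a 2 * (b 1 * b 3) + a 1 * a 3 * (b 0 * b 2)) = m₂ at *
    generalize X + (a 0 * a 3 * (b 1 * b 2) + a 1 * a 2 * (b 0 * b 3)) = m₃ at *
    have key (x m : ℚ) (hm : m ≠ 0) (hms : IsSquare m) (hx : IsSquare (x * m)) : IsSquare x :=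
      hms.of_mul_left hm (by rwa [mul_comm])
    constructor
    · rintro ⟨hs₁, hs₂, hs₃⟩
      have hcycle : ∃ δ : ℚ, (∃ z, linVal (a 0) (b 0) Q = δ * z ^ 2)
          ∧ (∃ z, linVal (a 1) (b 1) Q = δ * z ^ 2) ∧ (∃ z, linVal (a 2) (b 2) Q = δ * z ^ 2)
          ∧ ∃ z, linVal (a 3) (b 3) Q = δ * z ^ 2 := by
        -- Any two nonzero m's make four of the products squares, and these form a 4-cycle on the
        -- linear forms; at most one m is zero.
        by_cases hm₁ : m₁ = 0
        · have hm₂ := hm₁₂.resolve_left (not_not.mpr hm₁)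
          have hm₃ := hm₁₃.resolve_left (not_not.mpr hm₁)
          obtain ⟨δ, z₀, z₂, z₃, z₁⟩ := exists_eq_mul_sq_of_cycle (key _ _ hm₂ hs₂ h02)
            (by rw [mul_comm]; exact key _ _ hm₃ hs₃ h12) (key _ _ hm₃ hs₃ h03)
            (by rw [mul_comm]; exact key _ _ hm₂ hs₂ h13) (hne 0 1 (by decide))
            (hne 2 3 (by decide))
          exact ⟨δ, z₀, z₁, z₂, z₃⟩
        · by_cases hm₂ : m₂ = 0
          · have hm₃ := hm₂₃.resolve_left (not_not.mpr hm₂)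
            obtain ⟨δ, z₀, z₁, z₃, z₂⟩ := exists_eq_mul_sq_of_cycle (key _ _ hm₁ hs₁ h01)
              (key _ _ hm₃ hs₃ h12) (key _ _ hm₃ hs₃ h03)
              (by rw [mul_comm]; exact key _ _ hm₁ hs₁ h23) (hne 0 2 (by decide))
              (hne 1 3 (by decide))
            exact ⟨δ, z₀, z₁, z₂, z₃⟩
          · exact exists_eq_mul_sq_of_cycle (key _ _ hm₁ hs₁ h01) (key _ _ hm₂ hs₂ h13)
              (key _ _ hm₂ hs₂ h02) (key _ _ hm₁ hs₁ h23) (hne 0 3 (by decide))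
              (hne 1 2 (by decide))
      obtain ⟨δ, z₀, z₁, z₂, z₃⟩ := hcycle
      exact ⟨δ, Fin.forall_fin_succ.mpr ⟨z₀, Fin.forall_fin_succ.mpr
        ⟨z₁, Fin.forall_fin_two.mpr ⟨z₂, z₃⟩⟩⟩⟩
    · rintro ⟨δ, hδ⟩
      have hprod (i j : Fin 4) : IsSquare (linVal (a i) (b i) Q * linVal (a j) (b j) Q) := by
        obtain ⟨z, hz⟩ := hδ i
        obtain ⟨w, hw⟩ := hδ j
        exact ⟨δ * z * w, by rw [hz, hw]; ring⟩
      -- If f_i f_j vanishes at Q, then f_k f_l does not, and it determines the square class of m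
      -- instead.
      have hof (i j k l : Fin 4) (m : ℚ) (hik : i ≠ k) (hil : i ≠ l) (hjk : j ≠ k) (hjl : j ≠ l)
          (hij : IsSquare (linVal (a i) (b i) Q * linVal (a j) (b j) Q * m))
          (hkl : IsSquare (linVal (a k) (b k) Q * linVal (a l) (b l) Q * m)) : IsSquare m := by
        by_cases h0 : linVal (a i) (b i) Q * linVal (a j) (b j) Q = 0
        · refine (hprod k l).of_mul_left (mul_ne_zero ?_ ?_) hkl
          all_goals rcases mul_eq_zero.mp h0 with h0 | h0
          · exact (hne i k hik).resolve_left (not_not.mpr h0)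
          · exact (hne j k hjk).resolve_left (not_not.mpr h0)
          · exact (hne i l hil).resolve_left (not_not.mpr h0)
          · exact (hne j l hjl).resolve_left (not_not.mpr h0)
        · exact (hprod i j).of_mul_left h0 hij
      refine ⟨hof 0 1 2 3 m₁ ?_ ?_ ?_ ?_ h01 h23, hof 0 2 1 3 m₂ ?_ ?_ ?_ ?_ h02 h13,
        hof 0 3 1 2 m₃ ?_ ?_ ?_ ?_ h03 h12⟩ <;> decide

/-! ### Moving the identity to x = 0 -/

theorem translate_ofLinear (a b : Fin 4 → ℚ) (t : ℚ) :
    (ofLinear a b).translate t = ofLinear a fun i => a i * t + b i := by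
  simp only [translate, ofLinear, eval, Quartic.mk.injEq]
  refine ⟨trivial, ?_, ?_, ?_, ?_⟩ <;> ring

theorem translatePoint_surjective (C : Quartic) (t : ℚ) :
    Function.Surjective (C.translatePoint t) := by
  rintro (⟨x, y, h⟩ | ⟨r, h⟩)
  · exact ⟨.affine (x + t) y (by rw [h, eval_translate]), by simp [translatePoint]⟩
  · exact ⟨.infinity r h, rfl⟩

theorem linVal_translatePoint (C : Quartic) (t α β : ℚ) (Q : C.Point) :
    linVal α (α * t + β) (C.translatePoint t Q) = linVal α β Q := by
  rcases Q with ⟨x, y, h⟩ | ⟨r, h⟩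
  · simp only [translatePoint, linVal]
    ring
  · rfl

theorem mem_doubles_phiAt_iff (C : Quartic) (x₀ y₀ : ℚ) (h₀ : y₀ ^ 2 = C.eval x₀) (hy₀ : y₀ ≠ 0)
    (hΔ : C.Δ ≠ 0) (Q : C.Point) :
    Q ∈ doubles (C.phiAt x₀ y₀ h₀ hy₀ hΔ) ↔ C.translatePoint x₀ Q ∈
      doubles ((C.translate x₀).phi1 y₀ hy₀ h₀.symm (by rw [translate_Δ]; exact hΔ)) := by
  constructor
  · rintro ⟨R, hR⟩
    exact ⟨C.translatePoint x₀ R, hR⟩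
  · rintro ⟨R, hR⟩
    obtain ⟨R, rfl⟩ := C.translatePoint_surjective x₀ R
    exact ⟨R, hR⟩

theorem mem_doubles_phiAt_ofLinear_iff {a b : Fin 4 → ℚ} (ha : ∀ i, a i ≠ 0)
    (hΔ : (ofLinear a b).Δ ≠ 0) {x₀ y₀ : ℚ} (h₀ : y₀ ^ 2 = (ofLinear a b).eval x₀) (hy₀ : y₀ ≠ 0)
    (hsq : ∀ i j, IsSquare ((a i * x₀ + b i) * (a j * x₀ + b j))) (Q : (ofLinear a b).Point) :
    Q ∈ doubles ((ofLinear a b).phiAt x₀ y₀ h₀ hy₀ hΔ) ↔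
      ∃ δ : ℚ, ∀ i, ∃ z : ℚ, linVal (a i) (b i) Q = δ * z ^ 2 := by
  refine (mem_doubles_phiAt_iff ..).trans
    ((mem_doubles_phi1_iff (translate_ofLinear a b x₀) hy₀ _ _ ha hsq _).trans ?_)
  simp only [linVal_translatePoint]

end Quartic

/-! ### Extending D(q)-tuples, and the theorem -/

/-- Extensions of a `D(q)`-tuple by one element. -/
theorem exists_isDTuple_succ_iff {q : ℚ} {m : ℕ} {S : Finset ℚ} (hS : IsDTuple q m S) :
    (∃ T, S ⊆ T ∧ IsDTuple q (m + 1) T) ↔ ∃ x ∉ S, x ≠ 0 ∧ ∀ s ∈ S, IsSquare (s * x + q) := by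
  obtain ⟨hcard, hne, hsq⟩ := hS
  constructor
  · rintro ⟨T, hST, hT, hT0, hTsq⟩
    obtain ⟨x, hxT, hxS⟩ : ∃ x ∈ T, x ∉ S :=
      Finset.exists_mem_notMem_of_card_lt_card (by omega)
    exact ⟨x, hxS, hT0 x hxT, fun s hs =>
      hTsq s (hST hs) x hxT fun h => hxS (h ▸ hs)⟩
  · rintro ⟨x, hxS, hx, h⟩
    refine ⟨insert x S, Finset.subset_insert x S,
      by rw [Finset.card_insert_of_notMem hxS, hcard], ?_, ?_⟩
    · simpa [hx] using hne
    · intro s hs t ht hst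
      rcases Finset.mem_insert.mp hs with rfl | hs' <;>
        rcases Finset.mem_insert.mp ht with rfl | ht'
      · exact absurd rfl hst
      · rw [mul_comm]
        exact h t ht'
      · exact h s hs'
      · exact hsq s hs' t ht' hst

theorem corollary6p4 :
    (∀ (a b : Fin 4 → ℚ) (ha : ∀ i, a i ≠ 0) (hΔ : (Quartic.ofLinear a b).Δ ≠ 0)
      (x₀ y₀ : ℚ) (h₀ : y₀ ^ 2 = (Quartic.ofLinear a b).eval x₀)
      (hx₀ : ∀ i, x₀ ≠ -b i / a i),
      (∀ i j, IsSquare ((a i * x₀ + b i) * (a j * x₀ + b j))) →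
      ∀ Q : (Quartic.ofLinear a b).Point,
        Q ∈ Quartic.doubles ((Quartic.ofLinear a b).phiAt x₀ y₀ h₀
            (Quartic.ofLinear_y_ne_zero ha h₀ hx₀) hΔ) ↔
          ∃ δ : ℚ, ∀ i, ∃ z : ℚ, Quartic.linVal (a i) (b i) Q = δ * z ^ 2) ∧
    (∀ (q : ℚ) (hq : q ≠ 0) (a : Fin 4 → ℚ) (ha : Function.Injective a),
      IsDTuple q 4 (Finset.univ.image a) →
      ((∃ T : Finset ℚ, Finset.univ.image a ⊆ T ∧ IsDTuple q 5 T) ↔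
        ∃ (x y : ℚ) (h : y ^ 2 = (quadrupleCurve q a).eval x),
          Quartic.Point.affine x y h ∈ Quartic.doubles ((quadrupleCurve q a).phi1 (q ^ 2)
            (pow_ne_zero 2 hq) (quadrupleCurve_e q a) (quadrupleCurve_Δ hq ha)) ∧
          x ≠ 0 ∧ (∀ i, x ≠ a i) ∧
          ∃ δ : ℚ, IsSquare δ ∧ ∀ i, ∃ z : ℚ, a i * x + q = δ * z ^ 2)) := by
  refine ⟨fun a b ha hΔ x₀ y₀ h₀ hx₀ hsq Q =>
    Quartic.mem_doubles_phiAt_ofLinear_iff ha hΔ h₀ _ hsq Q, fun q hq a ha hS => ?_⟩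
  have ha0 : ∀ i, a i ≠ 0 := fun i => hS.2.1 _ (Finset.mem_image_of_mem a (Finset.mem_univ i))
  rw [exists_isDTuple_succ_iff hS]
  constructor
  · rintro ⟨x, hxS, hx, hsq⟩
    have hz : ∀ i, ∃ z, a i * x + q = z ^ 2 := fun i => by
      obtain ⟨z, hz⟩ := hsq _ (Finset.mem_image_of_mem a (Finset.mem_univ i))
      exact ⟨z, by rw [hz, sq]⟩
    have hδ : ∀ i, ∃ z, a i * x + q = 1 * z ^ 2 := by simpa only [one_mul] using hz
    choose z hz using hz
    -- The product of the square roots serves as y, and δ = 1.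
    refine ⟨x, ∏ i, z i, ?_, ?_, hx, fun i hi => ?_, 1, IsSquare.one, hδ⟩
    · rw [quadrupleCurve, Quartic.eval_ofLinear, ← Finset.prod_pow]
      exact Finset.prod_congr rfl fun i _ => (hz i).symm
    · exact (Quartic.mem_doubles_phi1_iff rfl _ _ _ ha0 (fun _ _ => ⟨q, rfl⟩) _).mpr ⟨1, hδ⟩
    · exact hxS (hi ▸ Finset.mem_image_of_mem a (Finset.mem_univ i))
  · rintro ⟨x, -, -, -, hx, hxa, δ, ⟨w, rfl⟩, hδ⟩
    -- Since δ = w², each a_i x + q is (wz)², so x itself extends the quadruple.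
    refine ⟨x, by simpa [eq_comm] using hxa, hx, fun s hs => ?_⟩
    obtain ⟨i, -, rfl⟩ := Finset.mem_image.mp hs
    obtain ⟨z, hz⟩ := hδ i
    exact ⟨w * z, by rw [hz]; ring⟩
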